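/- Let $K$ be a field, $n\ge 0$, $A=K[[X_1,\dots,X_n]]$, $\mathfrak m=(X_1,\dots,X_n)\subset A$ and $R=K[X_1,\dots,X_n]$ with its standard grading. For an $A$-module $M$ let $G_{\mathfrak m}(M)=\bigoplus_{i\ge 0}\mathfrak m^iM/\mathfrak m^{i+1}M$, a graded $R$-module through $R\cong G_{\mathfrak m}(A)$: a form $f$ of degree $i$ sends the class of $x\in\mathfrak m^jM$ to the class of $fx$ in $\mathfrak m^{i+j}M/\mathfrak m^{i+j+1}M$. A graded $R$-module $E$ has a *pure resolution* if it has a minimal graded free resolution of the form $$0\to R(-e_p)^{\gamma_p}\to\cdots\to R(-e_1)^{\gamma_1}\to R(-e_0)^{\gamma_0}\to E\to 0 .$$ For a non-zero $A$-linear map $\phi\colon A^b\to A^a$, the order $v(\phi)$ is the largest $s$ with $\operatorname{image}\phi\subseteq\mathfrak m^sA^a$, and the initial form $\operatorname{in}(\phi)$ is the matrix over $R$ whose entries are the homogeneous parts of degree $v(\phi)$ of the entries of the matrix of $\phi$; put $v(0)=0$ and $\operatorname{in}(0)=0$. **Theorem 1.1.** Let $M$ be a finitely generated $A$-module such that $G_{\mathfrak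 m}(M)$ has a pure resolution over $R$. Let $$\mathbb F\colon\ \cdots\to A^{\beta_2}\xrightarrow{\phi_2}A^{\beta_1}\xrightarrow{\phi_1}A^{\beta_0}\xrightarrow{\pi}M\to 0$$ be any minimal free resolution of $M$, and set $d_i=\sum_{j=1}^{i}v(\phi_j)$ for $i\ge 0$ (so $d_0=0$). Then $$\operatorname{in}(\mathbb F)\colon\ \cdots\to R(-d_2)^{\beta_2}\xrightarrow{\operatorname{in}(\phi_2)}R(-d_1)^{\beta_1}\xrightarrow{\operatorname{in}(\phi_1)}R^{\beta_0},$$ together with the natural map $\epsilon\colon R^{\beta_0}\to G_{\mathfrak m}(M)$ that sends the $j$-th basis vector to the class of $\pi(e_j)$ in $M/\mathfrak mM$, is a minimal graded free resolution of $G_{\mathfrak m}(M)$, and it has finite length. That is, the maps are homogeneous of degree $0$, $\epsilon$ is surjective, the augmented complex is exact, the image of $\operatorname{in}(\phi_i)$ lies in $(X_1,\dots,X_n)R^{\beta_{i-1}}$ for all $i\ge1$, and $\beta_i=0$ for all large $i$. -/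

import Mathlib

open scoped DirectSum

attribute [local instance] MvPolynomial.gradedAlgebra

namespace PureRes

/-- The power series ring `A = K[[X_1, …, X_n]]`. -/
abbrev PS (K : Type*) [Field K] (n : ℕ) : Type _ := MvPowerSeries (Fin n) K

/-- The polynomial ring `R = K[X_1, …, X_n]`. -/
abbrev Poly (K : Type*) [Field K] (n : ℕ) : Type _ := MvPolynomial (Fin n) K

/-- The maximal ideal `𝔪 = (X_1, …, X_n)` of `A`. -/
noncomputable def maxIdeal (K : Type*) [Field K] (n : ℕ) : Ideal (PS K n) :=
  Ideal.span (Set.range MvPowerSeries.X)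

/-- The irrelevant maximal ideal `(X_1, …, X_n)` of `R`. -/
noncomputable def irrelevantIdeal (K : Type*) [Field K] (n : ℕ) : Ideal (Poly K n) :=
  Ideal.span (Set.range MvPolynomial.X)

/-- A form of degree `d` lies in the `d`-th power of `𝔪`. -/
theorem coe_mem_pow {K : Type*} [Field K] {n : ℕ} {d : ℕ} {f : Poly K n}
    (hf : f ∈ MvPolynomial.homogeneousSubmodule (Fin n) K d) :
    (f : PS K n) ∈ maxIdeal K n ^ d := by
  rw [MvPolynomial.mem_homogeneousSubmodule] at hf
  rw [f.as_sum, ← MvPolynomial.coeToMvPowerSeries.ringHom_apply, map_sum]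
  refine Ideal.sum_mem _ fun m hm => ?_
  have hd : m.degree = d := by
    rw [Finsupp.degree_eq_weight_one]
    exact hf (MvPolynomial.mem_support_iff.mp hm)
  rw [MvPolynomial.monomial_eq, map_mul]
  refine Ideal.mul_mem_left _ _ ?_
  rw [Finsupp.prod, map_prod, ← hd, Finsupp.degree_apply, ← Finset.prod_pow_eq_pow_sum]
  refine Ideal.prod_mem_prod fun i _ => ?_
  have hX : (MvPowerSeries.X i : PS K n) ∈ maxIdeal K n := Ideal.subset_span ⟨i, rfl⟩
  simpa using Ideal.pow_mem_pow hX (m i)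

section AssociatedGraded

variable (K : Type*) [Field K] (n : ℕ) (M : Type*) [AddCommGroup M] [Module (PS K n) M]

/-- The submodule `𝔪 ^ i M` of `M`. -/
noncomputable def filt (i : ℕ) : Submodule (PS K n) M := maxIdeal K n ^ i • ⊤

/-- The `i`-th piece `𝔪 ^ i M / 𝔪 ^ (i + 1) M` of the associated graded module. -/
def GrPiece (i : ℕ) : Type _ :=
  filt K n M i ⧸ (filt K n M (i + 1)).submoduleOf (filt K n M i)

noncomputable instance (i : ℕ) : AddCommGroup (GrPiece K n M i) :=
  inferInstanceAs (AddCommGroup (filt K n M i ⧸ (filt K n M (i + 1)).submoduleOf (filt K n M i)))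

noncomputable instance (i : ℕ) : Module (PS K n) (GrPiece K n M i) :=
  inferInstanceAs
    (Module (PS K n) (filt K n M i ⧸ (filt K n M (i + 1)).submoduleOf (filt K n M i)))

variable {K n M}

/-- The class in `𝔪 ^ i M / 𝔪 ^ (i + 1) M` of an element of `𝔪 ^ i M`. -/
noncomputable def grMk (i : ℕ) (x : M) (hx : x ∈ filt K n M i) : GrPiece K n M i :=
  Submodule.Quotient.mk ⟨x, hx⟩

theorem smul_mem_filt {a : PS K n} {x : M} {i j : ℕ} (ha : a ∈ maxIdeal K n ^ i)
    (hx : x ∈ filt K n M j) : a • x ∈ filt K n M (i + j) := by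
  rw [filt, pow_add, ← smul_eq_mul, Submodule.smul_assoc]
  exact Submodule.smul_mem_smul ha hx

/-- Multiplication by an element of `𝔪 ^ i`, as a map
`𝔪 ^ j M / 𝔪 ^ (j + 1) M → 𝔪 ^ (i + j) M / 𝔪 ^ (i + j + 1) M`. -/
noncomputable def grSMul (i j : ℕ) (a : PS K n) (ha : a ∈ maxIdeal K n ^ i) :
    GrPiece K n M j →ₗ[PS K n] GrPiece K n M (i + j) :=
  Submodule.mapQ _ _
    ((LinearMap.lsmul (PS K n) M a).restrict fun _ hx => smul_mem_filt ha hx)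
    fun _ hx => smul_mem_filt (M := M) (j := j + 1) ha hx

theorem grSMul_grMk {i j : ℕ} {a : PS K n} (ha : a ∈ maxIdeal K n ^ i) {x : M}
    (hx : x ∈ filt K n M j) :
    grSMul i j a ha (grMk j x hx) = grMk (i + j) (a • x) (smul_mem_filt ha hx) := rfl

theorem grMk_surjective {i : ℕ} (y : GrPiece K n M i) : ∃ x hx, grMk i x hx = y := by
  obtain ⟨⟨x, hx⟩, rfl⟩ := Submodule.Quotient.mk_surjective _ y
  exact ⟨x, hx, rfl⟩

theorem mk_grMk_congr {i j : ℕ} (h : i = j) {x y : M} (hxy : x = y) (hx : x ∈ filt K n M i)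
    (hy : y ∈ filt K n M j) :
    (GradedMonoid.mk i (grMk i x hx) : GradedMonoid (GrPiece K n M)) =
      GradedMonoid.mk j (grMk j y hy) := by
  subst h; subst hxy; rfl

/-- A form `f` of degree `i` sends the class of `x ∈ 𝔪 ^ j M` to the class of `f x` in degree
`i + j`. -/
noncomputable instance : DirectSum.Gmodule (fun i => MvPolynomial.homogeneousSubmodule (Fin n) K i)
    (GrPiece K n M) where
  smul {i j} f y := grSMul i j (f : Poly K n) (coe_mem_pow f.2) y
  one_smul := by
    rintro ⟨j, y⟩
    obtain ⟨x, hx, rfl⟩ := grMk_surjective y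
    exact mk_grMk_congr (zero_add j) (by
      change (((1 : Poly K n) : PS K n)) • x = x
      simp) _ _
  mul_smul := by
    rintro ⟨i, f⟩ ⟨j, g⟩ ⟨k, y⟩
    obtain ⟨x, hx, rfl⟩ := grMk_surjective y
    exact mk_grMk_congr (add_assoc i j k) (by
      change (((f : Poly K n) * (g : Poly K n) : Poly K n) : PS K n) • x = _
      rw [MvPolynomial.coe_mul, mul_smul]
      rfl) _ _
  smul_add f := map_add _
  smul_zero f := map_zero _
  add_smul {i j} f g y := by
    obtain ⟨x, hx, rfl⟩ := grMk_surjective y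
    change grMk _ _ _ = grMk _ _ _ + grMk _ _ _
    refine congrArg Submodule.Quotient.mk (Subtype.ext ?_)
    change (((f : Poly K n) + (g : Poly K n) : Poly K n) : PS K n) • x = _
    rw [MvPolynomial.coe_add, add_smul]
    rfl
  zero_smul {i j} y := by
    obtain ⟨x, hx, rfl⟩ := grMk_surjective y
    change grMk _ _ _ = 0
    refine congrArg Submodule.Quotient.mk (Subtype.ext ?_)
    change (((0 : Poly K n)) : PS K n) • x = 0
    simp

variable (K n M)

/-- The associated graded module `G_𝔪(M) = ⨁ i, 𝔪 ^ i M / 𝔪 ^ (i + 1) M`. -/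
def AssocGraded : Type _ := ⨁ i, GrPiece K n M i

noncomputable instance : AddCommGroup (AssocGraded K n M) :=
  inferInstanceAs (AddCommGroup (⨁ i, GrPiece K n M i))

/-- `G_𝔪(M)` as a module over `R = K[X_1, …, X_n]`, identified with `G_𝔪(A)` by sending a form of
degree `i` to its class in `𝔪 ^ i / 𝔪 ^ (i + 1)`. -/
noncomputable instance : Module (Poly K n) (AssocGraded K n M) :=
  Module.compHom (⨁ i, GrPiece K n M i)
    (DirectSum.decomposeRingEquiv (MvPolynomial.homogeneousSubmodule (Fin n) K) :
      Poly K n ≃+* ⨁ i, MvPolynomial.homogeneousSubmodule (Fin n) K i).toRingHom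

/-- The inclusion of the `i`-th piece in `G_𝔪(M)`. -/
noncomputable def grOf (i : ℕ) : GrPiece K n M i →+ AssocGraded K n M :=
  DirectSum.of (GrPiece K n M) i

/-- The grading of `G_𝔪(M)`. -/
noncomputable def grGrading (i : ℕ) : AddSubgroup (AssocGraded K n M) := (grOf K n M i).range

variable {K n M}

/-- The action of `R` on `G_𝔪(M)` in terms of classes. -/
theorem smul_grOf_grMk {i j : ℕ} {f : Poly K n}
    (hf : f ∈ MvPolynomial.homogeneousSubmodule (Fin n) K i) {x : M} (hx : x ∈ filt K n M j) :
    f • grOf K n M j (grMk j x hx) =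
      grOf K n M (i + j) (grMk (i + j) ((f : PS K n) • x) (smul_mem_filt (coe_mem_pow hf) hx)) := by
  change DirectSum.decompose (MvPolynomial.homogeneousSubmodule (Fin n) K) f •
    DirectSum.of (GrPiece K n M) j (grMk j x hx) = _
  rw [DirectSum.decompose_of_mem _ hf]
  exact DirectSum.Gmodule.of_smul_of _ _ _ _

end AssociatedGraded

section Graded

variable {K : Type*} [Field K] {n : ℕ}

/-- The part of degree `e` of the graded free module `⨁ j, R(-d j)`: its elements are the families
of polynomials whose `j`-th member is a form of degree `e - d j` (zero if `e < d j`). -/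
def twist {b : ℕ} (d : Fin b → ℕ) (e : ℕ) : AddSubgroup (Fin b → Poly K n) where
  carrier := {v | ∀ j, ∀ m ∈ (v j).support, m.degree + d j = e}
  zero_mem' := by intro j m hm; simp at hm
  add_mem' := by
    classical
    intro v w hv hw j m hm
    rcases Finset.mem_union.mp (MvPolynomial.support_add hm) with h | h
    · exact hv j m h
    · exact hw j m h
  neg_mem' := by
    intro v hv j m hm
    exact hv j m (by simpa [MvPolynomial.mem_support_iff] using hm)

/-- The complex `⋯ → ⨁ j, R(-d 1 j) → ⨁ j, R(-d 0 j) → E → 0`, with `i`-th free module of rank `b i`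
and maps `φ i` from the `(i + 1)`-st to the `i`-th free module, is a minimal graded free resolution
(of finite length) of the `R`-module `E` with grading `ℰ`. -/
structure IsMinimalGradedFreeResolution {E : Type*} [AddCommGroup E] [Module (Poly K n) E]
    (ℰ : ℕ → AddSubgroup E) (b : ℕ → ℕ) (d : (i : ℕ) → Fin (b i) → ℕ)
    (φ : (i : ℕ) → (Fin (b (i + 1)) → Poly K n) →ₗ[Poly K n] (Fin (b i) → Poly K n))
    (ε : (Fin (b 0) → Poly K n) →ₗ[Poly K n] E) : Prop where
  finite_length : ∃ p, ∀ i, p < i → b i = 0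
  graded_map : ∀ i e, ∀ v ∈ twist (d (i + 1)) e, φ i v ∈ twist (d i) e
  graded_augmentation : ∀ e, ∀ v ∈ twist (d 0) e, ε v ∈ ℰ e
  augmentation_surjective : Function.Surjective ε
  exact_zero : Function.Exact (φ 0) ε
  exact_succ : ∀ i, Function.Exact (φ (i + 1)) (φ i)
  minimal : ∀ i, LinearMap.range (φ i) ≤ irrelevantIdeal K n • ⊤

/-- The graded module `(E, ℰ)` has a pure resolution: a minimal graded free resolution of the form
`0 → R(-d p) ^ b p → ⋯ → R(-d 1) ^ b 1 → R(-d 0) ^ b 0 → E → 0`. -/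
def HasPureResolution (K : Type*) [Field K] (n : ℕ) {E : Type*} [AddCommGroup E] [Module (Poly K n) E]
    (ℰ : ℕ → AddSubgroup E) : Prop :=
  ∃ (b d : ℕ → ℕ)
    (φ : (i : ℕ) → (Fin (b (i + 1)) → Poly K n) →ₗ[Poly K n] (Fin (b i) → Poly K n))
    (ε : (Fin (b 0) → Poly K n) →ₗ[Poly K n] E),
    IsMinimalGradedFreeResolution ℰ b (fun i _ => d i) φ ε

end Graded

section Local

variable {K : Type*} [Field K] {n : ℕ} {M : Type*} [AddCommGroup M] [Module (PS K n) M]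

/-- The complex `⋯ → A ^ b 1 → A ^ b 0 → M → 0` is a minimal free resolution of `M`. -/
structure IsMinimalFreeResolution (b : ℕ → ℕ)
    (φ : (i : ℕ) → (Fin (b (i + 1)) → PS K n) →ₗ[PS K n] (Fin (b i) → PS K n))
    (π : (Fin (b 0) → PS K n) →ₗ[PS K n] M) : Prop where
  augmentation_surjective : Function.Surjective π
  exact_zero : Function.Exact (φ 0) π
  exact_succ : ∀ i, Function.Exact (φ (i + 1)) (φ i)
  minimal : ∀ i, LinearMap.range (φ i) ≤ maxIdeal K n • ⊤

/-- The order `v(φ)`: the largest `s` with `image φ ⊆ 𝔪 ^ s A ^ a`. For `φ = 0` there is no largest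
such `s`, and the value is `0`. -/
noncomputable def order {a b : ℕ} (φ : (Fin b → PS K n) →ₗ[PS K n] (Fin a → PS K n)) : ℕ :=
  sSup {s : ℕ | LinearMap.range φ ≤ maxIdeal K n ^ s • ⊤}

/-- The homogeneous part of degree `s` of a power series, as a polynomial. -/
noncomputable def formPart (s : ℕ) (f : PS K n) : Poly K n :=
  MvPolynomial.homogeneousComponent s (MvPowerSeries.truncTotal (s + 1) f)

theorem coeff_formPart (s : ℕ) (f : PS K n) (m : Fin n →₀ ℕ) :
    (formPart s f).coeff m = if m.degree = s then MvPowerSeries.coeff m f else 0 := by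
  rw [formPart, MvPolynomial.coeff_homogeneousComponent]
  split_ifs with h
  · exact MvPowerSeries.coeff_truncTotal _ (by omega)
  · rfl

/-- The initial form `in(φ)`: the matrix of the homogeneous parts of degree `v(φ)` of the entries of
the matrix of `φ`, as a map between free `R`-modules. -/
noncomputable def initialForm {a b : ℕ} (φ : (Fin b → PS K n) →ₗ[PS K n] (Fin a → PS K n)) :
    (Fin b → Poly K n) →ₗ[Poly K n] (Fin a → Poly K n) :=
  Matrix.toLin' ((LinearMap.toMatrix' φ).map (formPart (order φ)))

/-- The natural map `R ^ b = G_𝔪(A ^ b) → G_𝔪(M)` induced by `π : A ^ b → M`: it sends the `j`-th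
basis vector to the class of `π e_j` in `M / 𝔪 M`. -/
noncomputable def augmentation {b : ℕ} (π : (Fin b → PS K n) →ₗ[PS K n] M) :
    (Fin b → Poly K n) →ₗ[Poly K n] AssocGraded K n M :=
  Fintype.linearCombination (Poly K n) fun j =>
    grOf K n M 0 (grMk 0 (π (Pi.single j 1)) (by simp [filt]))

end Local

end PureRes

namespace PureRes

/-! ### Ideal multiples of finite free modules, coordinate by coordinate -/

section Pi

/-! For a submodule `N` of `A ^ a`, let `N*` (`initialModule N`) be the `R`-module generated by the
leading forms of its members. The syzygies of `G_𝔪(M)` are leading forms of the syzygies of `M`: the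
kernel of the augmentation is `(ker π)*` (`ker_augmentation`).

The central point concerns one map `φ` for which `(im φ)*` is generated by forms of a single degree
`e`. Then `e` is the order of `φ` unless `φ = 0`, and `in(φ)` has image `(im φ)*`. Successive
approximation in the complete ring `A` shows that `φ` is strict: a member of `im φ` in `𝔪 ^ (e + t)
A ^ a` comes from `𝔪 ^ t A ^ b` (`exists_map_eq`). Strictness corrects a lift of a form killed by
`in(φ)` to a true member of `ker φ`, so `ker in(φ) = (ker φ)*` (`ker_formMap`). Since `ker φ` is the
image of the next map, this yields exactness as soon as the next map satisfies the same hypothesis.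

Purity supplies that hypothesis. Minimal generating systems in one degree differ by an invertible
matrix of constants (`exists_constant_equiv`), so each `(ker φ)*` is isomorphic to the corresponding
syzygy module of the given pure resolution, hence again generated in one degree. The induction runs
on the length of that resolution. At its end `N* = 0` forces `N = 0`, because the filtration is
separated, and minimality kills all later ranks. -/

theorem mem_smul_top_pi {S : Type*} [CommRing S] {a : ℕ} (I : Ideal S) (v : Fin a → S) :
    v ∈ I • (⊤ : Submodule S (Fin a → S)) ↔ ∀ j, v j ∈ I := by
  constructor
  · intro hv j
    have h := Submodule.mem_map_of_mem (f := LinearMap.proj (R := S) (φ := fun _ : Fin a => S) j) hv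
    rw [Submodule.map_smul''] at h
    simpa using (Submodule.smul_mono (le_refl I) (le_top (α := Submodule S S))) h
  · intro hv
    rw [pi_eq_sum_univ' v]
    refine Submodule.sum_mem _ fun j _ => Submodule.smul_mem_smul (hv j) trivial

end Pi

/-! ### Powers of `𝔪` and leading forms of power series -/

section PowerSeries

variable {K : Type*} [Field K] {n : ℕ}

/-- Each monomial of positive degree is assigned to one variable that divides it; `g i` collects the
monomials assigned to `X i`, divided by `X i`. This also handles infinitely many monomials at once.
-/
theorem exists_eq_sum_X_mul {s : ℕ} {x : PS K n}
    (hx : ∀ m : Fin n →₀ ℕ, m.degree < s + 1 → MvPowerSeries.coeff m x = 0) :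
    ∃ g : Fin n → PS K n, x = ∑ i, g i * MvPowerSeries.X i ∧
      ∀ i m, m.degree < s → MvPowerSeries.coeff m (g i) = 0 := by
  classical
  have hsupp : ∀ m : Fin n →₀ ℕ, m ≠ 0 → ∃ i, m i ≠ 0 := fun m hm => Finsupp.ne_iff.mp hm
  rcases isEmpty_or_nonempty (Fin n) with hn | hn
  · refine ⟨0, ?_, fun i => isEmptyElim i⟩
    ext m
    rw [hx m (by simp [Subsingleton.elim m 0])]
    simp
  choose! c hc using hsupp
  obtain ⟨g, hg⟩ : ∃ g : Fin n → PS K n, ∀ i m, MvPowerSeries.coeff m (g i) =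
      if c (m + Finsupp.single i 1) = i then
        MvPowerSeries.coeff (m + Finsupp.single i 1) x else 0 :=
    ⟨fun i m => if c (m + Finsupp.single i 1) = i then
      MvPowerSeries.coeff (m + Finsupp.single i 1) x else 0, fun _ _ => rfl⟩
  refine ⟨g, ?_, fun i m hm => ?_⟩
  · ext m
    rw [map_sum]
    simp_rw [MvPowerSeries.X, MvPowerSeries.coeff_mul_monomial, mul_one]
    by_cases hm : m = 0
    · subst hm
      rw [hx _ (by simp), Finset.sum_eq_zero]
      intro i _
      rw [if_neg]
      intro h
      simpa using h i
    · rw [Finset.sum_eq_single (c m)]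
      · have hle : Finsupp.single (c m) 1 ≤ m := by
          rw [Finsupp.single_le_iff]
          exact Nat.one_le_iff_ne_zero.mpr (hc m hm)
        rw [if_pos hle, hg, tsub_add_cancel_of_le hle, if_pos rfl]
      · intro i _ hi
        split_ifs with hle
        · rw [hg, tsub_add_cancel_of_le hle, if_neg (Ne.symm hi)]
        · rfl
      · simp
  · rw [hg]
    split_ifs
    · exact hx _ (by rw [map_add, Finsupp.degree_single]; omega)
    · rfl

/-- `𝔪 ^ s` consists of the power series without terms of degree less than `s`. -/
theorem mem_maxIdeal_pow {s : ℕ} {x : PS K n} :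
    x ∈ maxIdeal K n ^ s ↔ ∀ m : Fin n →₀ ℕ, m.degree < s → MvPowerSeries.coeff m x = 0 := by
  constructor
  · intro hx
    suffices h : (s : ℕ∞) ≤ x.order from fun m hm =>
      MvPowerSeries.coeff_of_lt_order (lt_of_lt_of_le (by exact_mod_cast hm) h)
    have h1 : ∀ y ∈ maxIdeal K n, 1 ≤ y.order := by
      intro y hy
      rw [MvPowerSeries.one_le_order_iff_constCoeff_eq_zero]
      change y ∈ RingHom.ker (MvPowerSeries.constantCoeff (σ := Fin n) (R := K))
      refine (Ideal.span_le.mpr ?_ : maxIdeal K n ≤ _) hy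
      rintro _ ⟨i, rfl⟩
      simp [RingHom.mem_ker]
    induction s generalizing x with
    | zero => simp
    | succ s ih =>
      rw [pow_succ] at hx
      induction hx using Submodule.mul_induction_on' with
      | mem_mul_mem y hy z hz =>
        push_cast
        exact (add_le_add (ih hy) (h1 z hz)).trans MvPowerSeries.le_order_mul
      | add y _ z _ hy hz => exact (le_min hy hz).trans MvPowerSeries.min_order_le_add
  · induction s generalizing x with
    | zero => simp
    | succ s ih =>
      intro hx
      obtain ⟨g, rfl, hg⟩ := exists_eq_sum_X_mul hx
      refine Ideal.sum_mem _ fun i _ => ?_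
      rw [pow_succ]
      exact Ideal.mul_mem_mul (ih (hg i)) (Ideal.subset_span ⟨i, rfl⟩)

theorem mem_irrelevantIdeal {p : Poly K n} : p ∈ irrelevantIdeal K n ↔ p.coeff 0 = 0 := by
  have h := MvPolynomial.mem_pow_idealOfVars_iff' (R := K) (σ := Fin n) 1 p
  rw [pow_one] at h
  refine h.trans ⟨fun h => h 0 (by simp), fun h m hm => ?_⟩
  rw [Nat.lt_one_iff, Finsupp.degree_eq_zero_iff] at hm
  rw [hm, h]

theorem formPart_isHomogeneous (s : ℕ) (x : PS K n) : (formPart s x).IsHomogeneous s :=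
  MvPolynomial.homogeneousComponent_isHomogeneous _ _

theorem formPart_coe (s : ℕ) (p : Poly K n) :
    formPart s (p : PS K n) = MvPolynomial.homogeneousComponent s p := by
  ext m
  rw [coeff_formPart, MvPolynomial.coeff_homogeneousComponent, MvPolynomial.coeff_coe]

theorem coe_formPart (s : ℕ) (x : PS K n) :
    (formPart s x : PS K n) = MvPowerSeries.homogeneousComponent s x := by
  ext m
  rw [MvPolynomial.coeff_coe, coeff_formPart, MvPowerSeries.coeff_homogeneousComponent]

theorem natCast_le_order {s : ℕ} {x : PS K n} (hx : x ∈ maxIdeal K n ^ s) : (s : ℕ∞) ≤ x.order :=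
  MvPowerSeries.nat_le_order (mem_maxIdeal_pow.mp hx)

theorem formPart_mul {s t : ℕ} {x y : PS K n} (hx : x ∈ maxIdeal K n ^ s)
    (hy : y ∈ maxIdeal K n ^ t) : formPart (s + t) (x * y) = formPart s x * formPart t y := by
  apply MvPolynomial.coe_injective
  rw [MvPolynomial.coe_mul, coe_formPart, coe_formPart, coe_formPart]
  exact MvPowerSeries.homogeneousComponent_mul_of_le_order (natCast_le_order hx)
    (natCast_le_order hy)

theorem homogeneousComponent_mul_of_isHomogeneous {s : ℕ} {p : Poly K n} (hp : p.IsHomogeneous s)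
    (q : Poly K n) (t : ℕ) :
    MvPolynomial.homogeneousComponent t (p * q) =
      if s ≤ t then p * MvPolynomial.homogeneousComponent (t - s) q else 0 := by
  simp_rw [← MvPolynomial.decomposition.decompose'_apply]
  split_ifs with h
  · have := DirectSum.coe_decompose_mul_of_left_mem_of_le
      (MvPolynomial.homogeneousSubmodule (Fin n) K) (b := q) (hp : p ∈ _) h
    exact this
  · exact DirectSum.coe_decompose_mul_of_left_mem_of_not_le
      (MvPolynomial.homogeneousSubmodule (Fin n) K) (b := q) (hp : p ∈ _) h

theorem formPart_eq_zero {s : ℕ} {x : PS K n} (hx : x ∈ maxIdeal K n ^ (s + 1)) :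
    formPart s x = 0 := by
  ext m
  rw [coeff_formPart]
  split_ifs with h
  · exact mem_maxIdeal_pow.mp hx m (by omega)
  · rfl

theorem mem_maxIdeal_pow_succ {s : ℕ} {x : PS K n} (hx : x ∈ maxIdeal K n ^ s)
    (h : formPart s x = 0) : x ∈ maxIdeal K n ^ (s + 1) := by
  rw [mem_maxIdeal_pow] at hx ⊢
  intro m hm
  rcases Nat.lt_succ_iff_lt_or_eq.mp hm with h' | h'
  · exact hx m h'
  · have := coeff_formPart s x m
    rw [h, if_pos h'] at this
    simpa using this.symm

theorem eq_zero_of_forall_mem {x : PS K n} (hx : ∀ s, x ∈ maxIdeal K n ^ s) : x = 0 := by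
  ext m
  exact mem_maxIdeal_pow.mp (hx (m.degree + 1)) m (by omega)

end PowerSeries

/-! ### Leading forms of vectors -/

section Vectors

variable {K : Type*} [Field K] {n a : ℕ}

/-- The vectors of power series without terms of degree less than `s`. -/
theorem mem_filt_pi {s : ℕ} {x : Fin a → PS K n} :
    x ∈ filt K n (Fin a → PS K n) s ↔ ∀ j, x j ∈ maxIdeal K n ^ s :=
  mem_smul_top_pi _ _

theorem filt_anti {M : Type*} [AddCommGroup M] [Module (PS K n) M] {s t : ℕ} (h : s ≤ t) :
    filt K n M t ≤ filt K n M s :=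
  Submodule.smul_mono_left (Ideal.pow_le_pow_right h)

theorem map_filt {M N : Type*} [AddCommGroup M] [Module (PS K n) M] [AddCommGroup N]
    [Module (PS K n) N] (f : M →ₗ[PS K n] N) (s : ℕ) :
    (filt K n M s).map f = maxIdeal K n ^ s • LinearMap.range f := by
  rw [filt, Submodule.map_smul'', LinearMap.range_eq_map]

theorem map_mem_filt {M N : Type*} [AddCommGroup M] [Module (PS K n) M] [AddCommGroup N]
    [Module (PS K n) N] (f : M →ₗ[PS K n] N) {s : ℕ} {x : M} (hx : x ∈ filt K n M s) :
    f x ∈ filt K n N s := by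
  have h := Submodule.mem_map_of_mem (f := f) hx
  rw [map_filt] at h
  exact Submodule.smul_mono le_rfl le_top h

/-- The vector of homogeneous parts of degree `s` of a vector of power series. -/
noncomputable def vecForm (a s : ℕ) : (Fin a → PS K n) →+ (Fin a → Poly K n) where
  toFun x j := formPart s (x j)
  map_zero' := by
    ext j m
    simp [coeff_formPart]
  map_add' x y := by
    ext j m
    simp only [coeff_formPart, Pi.add_apply, MvPolynomial.coeff_add, map_add]
    split_ifs <;> simp

theorem vecForm_apply (s : ℕ) (x : Fin a → PS K n) (j : Fin a) :
    vecForm a s x j = formPart s (x j) := rfl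

/-- The vector of homogeneous components of degree `s` of a vector of polynomials. -/
noncomputable def vecComponent (a s : ℕ) : (Fin a → Poly K n) →ₗ[K] (Fin a → Poly K n) :=
  LinearMap.compLeft (MvPolynomial.homogeneousComponent s) (Fin a)

theorem vecComponent_apply (s : ℕ) (w : Fin a → Poly K n) (j : Fin a) :
    vecComponent a s w j = MvPolynomial.homogeneousComponent s (w j) := rfl

/-- A vector of polynomials as a vector of power series. -/
noncomputable def vecCoe (a : ℕ) : (Fin a → Poly K n) →ₗ[K] (Fin a → PS K n) :=
  LinearMap.compLeft (MvPolynomial.coeToMvPowerSeries.algHom K).toLinearMap (Fin a)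

theorem vecCoe_apply (w : Fin a → Poly K n) (j : Fin a) : vecCoe a w j = (w j : PS K n) := by
  simp [vecCoe]

theorem vecForm_vecCoe (s : ℕ) (w : Fin a → Poly K n) :
    vecForm a s (vecCoe a w) = vecComponent a s w := by
  funext j
  rw [vecForm_apply, vecCoe_apply, formPart_coe, vecComponent_apply]

theorem vecCoe_mem_filt {s : ℕ} {w : Fin a → Poly K n} (hw : ∀ j, (w j).IsHomogeneous s) :
    vecCoe a w ∈ filt K n (Fin a → PS K n) s := by
  rw [mem_filt_pi]
  intro j
  rw [vecCoe_apply]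
  exact coe_mem_pow (hw j)

theorem vecComponent_isHomogeneous (s : ℕ) (w : Fin a → Poly K n) (j : Fin a) :
    (vecComponent a s w j).IsHomogeneous s :=
  MvPolynomial.homogeneousComponent_isHomogeneous _ _

theorem vecForm_isHomogeneous (s : ℕ) (x : Fin a → PS K n) (j : Fin a) :
    (vecForm a s x j).IsHomogeneous s :=
  formPart_isHomogeneous _ _

theorem vecComponent_of_isHomogeneous {s : ℕ} {w : Fin a → Poly K n}
    (hw : ∀ j, (w j).IsHomogeneous s) (t : ℕ) :
    vecComponent a t w = if t = s then w else 0 := by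
  funext j
  rw [vecComponent_apply, MvPolynomial.homogeneousComponent_of_mem (hw j)]
  split_ifs <;> rfl

theorem vecForm_eq_zero {s : ℕ} {x : Fin a → PS K n} (hx : x ∈ filt K n (Fin a → PS K n) (s + 1)) :
    vecForm a s x = 0 :=
  funext fun j => formPart_eq_zero (mem_filt_pi.mp hx j)

theorem mem_filt_succ {s : ℕ} {x : Fin a → PS K n} (hx : x ∈ filt K n (Fin a → PS K n) s)
    (h : vecForm a s x = 0) : x ∈ filt K n (Fin a → PS K n) (s + 1) :=
  mem_filt_pi.mpr fun j => mem_maxIdeal_pow_succ (mem_filt_pi.mp hx j) (congrFun h j)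

theorem eq_zero_of_forall_mem_filt {x : Fin a → PS K n}
    (hx : ∀ s, x ∈ filt K n (Fin a → PS K n) s) : x = 0 :=
  funext fun j => eq_zero_of_forall_mem fun s => mem_filt_pi.mp (hx s) j

theorem sub_vecCoe_vecForm_mem {s : ℕ} {x : Fin a → PS K n}
    (hx : x ∈ filt K n (Fin a → PS K n) s) :
    x - vecCoe a (vecForm a s x) ∈ filt K n (Fin a → PS K n) (s + 1) := by
  refine mem_filt_succ (Submodule.sub_mem _ hx (vecCoe_mem_filt (vecForm_isHomogeneous s x))) ?_
  rw [map_sub, vecForm_vecCoe, vecComponent_of_isHomogeneous (vecForm_isHomogeneous s x),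
    if_pos rfl, sub_self]

theorem exists_eq_sum_vecComponent (w : Fin a → Poly K n) :
    ∃ N, w = ∑ s ∈ Finset.range N, vecComponent a s w := by
  refine ⟨(Finset.univ.sup fun j => (w j).totalDegree) + 1, funext fun j => ?_⟩
  rw [Finset.sum_apply]
  simp only [vecComponent_apply]
  have hj : (w j).totalDegree + 1 ≤ (Finset.univ.sup fun j => (w j).totalDegree) + 1 :=
    Nat.succ_le_succ (Finset.le_sup (f := fun j => (w j).totalDegree) (Finset.mem_univ j))
  rw [← Finset.sum_subset (Finset.range_mono hj), MvPolynomial.sum_homogeneousComponent]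
  intro s _ hs
  exact MvPolynomial.homogeneousComponent_eq_zero _ _ (by simpa using hs)

theorem mem_of_forall_vecComponent_mem {W : Submodule (Poly K n) (Fin a → Poly K n)}
    {w : Fin a → Poly K n} (h : ∀ s, vecComponent a s w ∈ W) : w ∈ W := by
  obtain ⟨N, hN⟩ := exists_eq_sum_vecComponent w
  rw [hN]
  exact Submodule.sum_mem _ fun s _ => h s

end Vectors

/-! ### The module of initial forms -/

section InitialModule

variable {K : Type*} [Field K] {n a : ℕ}

theorem vecComponent_smul_of_isHomogeneous {d : ℕ} {p : Poly K n} (hp : p.IsHomogeneous d)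
    (w : Fin a → Poly K n) (t : ℕ) :
    vecComponent a t (p • w) = if d ≤ t then p • vecComponent a (t - d) w else 0 := by
  funext j
  rw [vecComponent_apply, Pi.smul_apply, smul_eq_mul, homogeneousComponent_mul_of_isHomogeneous hp]
  split_ifs <;> rfl

theorem vecForm_coe_smul {s d : ℕ} {p : Poly K n} (hp : p.IsHomogeneous d) {x : Fin a → PS K n}
    (hx : x ∈ filt K n (Fin a → PS K n) s) :
    vecForm a (d + s) ((p : PS K n) • x) = p • vecForm a s x := by
  funext j
  rw [vecForm_apply, Pi.smul_apply, smul_eq_mul, formPart_mul (coe_mem_pow hp) (mem_filt_pi.mp hx j),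
    formPart_coe, MvPolynomial.homogeneousComponent_of_mem hp, if_pos rfl]
  rfl

/-- The module of initial forms of a submodule `N` of `A ^ a`: the vectors all of whose homogeneous
components are forms of degree `s` of members of `N ∩ 𝔪 ^ s A ^ a`. -/
noncomputable def initialModule (N : Submodule (PS K n) (Fin a → PS K n)) :
    Submodule (Poly K n) (Fin a → Poly K n) where
  carrier := {w | ∀ s, ∃ x ∈ N, x ∈ filt K n (Fin a → PS K n) s ∧
    vecForm a s x = vecComponent a s w}
  zero_mem' s := ⟨0, N.zero_mem, Submodule.zero_mem _, by simp⟩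
  add_mem' {v w} hv hw s := by
    obtain ⟨x, hx, hxs, hxv⟩ := hv s
    obtain ⟨y, hy, hys, hyw⟩ := hw s
    exact ⟨x + y, N.add_mem hx hy, Submodule.add_mem _ hxs hys, by rw [map_add, map_add, hxv, hyw]⟩
  smul_mem' p w hw s := by
    -- Leading forms are compatible only with multiplication by forms, so `p` is split into its
    -- homogeneous components.
    suffices h : ∀ d, ∃ x ∈ N, x ∈ filt K n (Fin a → PS K n) s ∧
        vecForm a s x = vecComponent a s (MvPolynomial.homogeneousComponent d p • w) by
      choose x hxN hxs hx using h
      refine ⟨∑ d ∈ Finset.range (p.totalDegree + 1), x d, Submodule.sum_mem _ fun d _ => hxN d,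
        Submodule.sum_mem _ fun d _ => hxs d, ?_⟩
      rw [map_sum, Finset.sum_congr rfl fun d _ => hx d, ← map_sum, ← Finset.sum_smul,
        MvPolynomial.sum_homogeneousComponent]
    intro d
    have hp := MvPolynomial.homogeneousComponent_isHomogeneous d p
    rw [vecComponent_smul_of_isHomogeneous hp]
    split_ifs with hd
    · obtain ⟨x, hx, hxs, hxw⟩ := hw (s - d)
      refine ⟨((MvPolynomial.homogeneousComponent d p : Poly K n) : PS K n) • x,
        N.smul_mem _ hx, ?_, ?_⟩
      · have := smul_mem_filt (coe_mem_pow hp) hxs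
        rwa [Nat.add_sub_cancel' hd] at this
      · have := vecForm_coe_smul hp hxs
        rwa [Nat.add_sub_cancel' hd, hxw] at this
    · exact ⟨0, N.zero_mem, Submodule.zero_mem _, map_zero _⟩

theorem vecForm_mem_initialModule {N : Submodule (PS K n) (Fin a → PS K n)} {s : ℕ}
    {x : Fin a → PS K n} (hx : x ∈ N) (hxs : x ∈ filt K n (Fin a → PS K n) s) :
    vecForm a s x ∈ initialModule N := by
  intro t
  rw [vecComponent_of_isHomogeneous (vecForm_isHomogeneous s x)]
  split_ifs with h
  · exact ⟨x, hx, h ▸ hxs, by rw [h]⟩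
  · exact ⟨0, N.zero_mem, Submodule.zero_mem _, map_zero _⟩

/-- The forms of degree less than `s` in the module of initial forms bound the order from below. -/
theorem le_filt_of_forall_lt {N : Submodule (PS K n) (Fin a → PS K n)} {s : ℕ}
    (h : ∀ t < s, ∀ w ∈ initialModule N, vecComponent a t w = 0) :
    N ≤ filt K n (Fin a → PS K n) s := by
  intro x hx
  induction s with
  | zero => simp [mem_filt_pi]
  | succ s ih =>
    have hxs := ih fun t ht => h t (ht.trans s.lt_succ_self)
    refine mem_filt_succ hxs ?_
    have := h s s.lt_succ_self _ (vecForm_mem_initialModule hx hxs)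
    rwa [vecComponent_of_isHomogeneous (vecForm_isHomogeneous s x), if_pos rfl] at this

/-- A member of `N` without any leading form lies in every `𝔪 ^ s A ^ a`, and the intersection of
these is zero. -/
theorem eq_bot_of_initialModule_eq_bot {N : Submodule (PS K n) (Fin a → PS K n)}
    (h : initialModule N = ⊥) : N = ⊥ := by
  rw [eq_bot_iff]
  intro x hx
  refine (Submodule.mem_bot _).mpr (eq_zero_of_forall_mem_filt fun s => ?_)
  refine le_filt_of_forall_lt (fun t _ w hw => ?_) hx
  rw [h, Submodule.mem_bot] at hw
  rw [hw, map_zero]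

theorem initialModule_le_irrelevantIdeal {N : Submodule (PS K n) (Fin a → PS K n)}
    (h : N ≤ maxIdeal K n • ⊤) : initialModule N ≤ irrelevantIdeal K n • ⊤ := by
  intro w hw
  rw [mem_smul_top_pi]
  intro j
  obtain ⟨x, hx, -, hxw⟩ := hw 0
  have hx1 : x ∈ filt K n (Fin a → PS K n) (0 + 1) := by
    rw [filt, zero_add, pow_one]
    exact h hx
  rw [vecForm_eq_zero hx1] at hxw
  have h0 := congrArg (MvPolynomial.coeff 0) (congrFun hxw j)
  rw [vecComponent_apply, MvPolynomial.coeff_homogeneousComponent, if_pos (by simp)] at h0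
  rw [mem_irrelevantIdeal, ← h0]
  simp

end InitialModule

/-! ### Matrices of forms and uniqueness of minimal presentations in one degree -/

section HomogeneousMaps

variable {K : Type*} [Field K] {n a b c : ℕ}

/-- The matrix of `ψ` has entries homogeneous of degree `e`. -/
def HasFormEntries (e : ℕ) (ψ : (Fin b → Poly K n) →ₗ[Poly K n] (Fin a → Poly K n)) : Prop :=
  ∀ j i, (ψ (Pi.single j 1) i).IsHomogeneous e

theorem map_eq_sum_smul {S M : Type*} [CommRing S] [AddCommGroup M] [Module S M]
    (f : (Fin b → S) →ₗ[S] M) (v : Fin b → S) : f v = ∑ j, v j • f (Pi.single j 1) := by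
  conv_lhs => rw [pi_eq_sum_univ' v, map_sum]
  exact Finset.sum_congr rfl fun j _ => map_smul _ _ _

namespace HasFormEntries

variable {e : ℕ} {ψ : (Fin b → Poly K n) →ₗ[Poly K n] (Fin a → Poly K n)}

theorem vecComponent_map (hψ : HasFormEntries e ψ) (t : ℕ) (w : Fin b → Poly K n) :
    vecComponent a t (ψ w) = if e ≤ t then ψ (vecComponent b (t - e) w) else 0 := by
  rw [map_eq_sum_smul ψ w, map_eq_sum_smul ψ (vecComponent b (t - e) w), map_sum]
  have h : ∀ j, vecComponent a t (w j • ψ (Pi.single j 1)) =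
      if e ≤ t then vecComponent b (t - e) w j • ψ (Pi.single j 1) else 0 := by
    intro j
    funext i
    rw [vecComponent_apply, Pi.smul_apply, smul_eq_mul, mul_comm,
      homogeneousComponent_mul_of_isHomogeneous (hψ j i)]
    split_ifs
    · rw [mul_comm]; rfl
    · rfl
  rw [Finset.sum_congr rfl fun j _ => h j]
  split_ifs <;> simp

theorem vecComponent_add_map (hψ : HasFormEntries e ψ) (t : ℕ) (w : Fin b → Poly K n) :
    vecComponent a (e + t) (ψ w) = ψ (vecComponent b t w) := by
  rw [hψ.vecComponent_map, if_pos (Nat.le_add_right e t), Nat.add_sub_cancel_left]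

theorem isHomogeneous_map (hψ : HasFormEntries e ψ) {t : ℕ} {w : Fin b → Poly K n}
    (hw : ∀ j, (w j).IsHomogeneous t) (i : Fin a) : (ψ w i).IsHomogeneous (e + t) := by
  have h := hψ.vecComponent_add_map t w
  rw [vecComponent_of_isHomogeneous hw, if_pos rfl] at h
  rw [← h]
  exact vecComponent_isHomogeneous _ _ _

theorem comp {d : ℕ} {χ : (Fin c → Poly K n) →ₗ[Poly K n] (Fin b → Poly K n)}
    (hψ : HasFormEntries e ψ) (hχ : HasFormEntries d χ) : HasFormEntries (e + d) (ψ ∘ₗ χ) :=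
  fun j => hψ.isHomogeneous_map (hχ j)

end HasFormEntries

theorem single_one_isHomogeneous (j i : Fin b) :
    ((Pi.single j 1 : Fin b → Poly K n) i).IsHomogeneous 0 := by
  by_cases h : i = j
  · subst h
    rw [Pi.single_eq_same]
    exact MvPolynomial.isHomogeneous_one _ _
  · rw [Pi.single_eq_of_ne h]
    exact MvPolynomial.isHomogeneous_zero _ _ _

theorem eq_zero_of_isHomogeneous_zero {w : Fin b → Poly K n} (hw : ∀ j, (w j).IsHomogeneous 0)
    (h : w ∈ irrelevantIdeal K n • (⊤ : Submodule (Poly K n) (Fin b → Poly K n))) : w = 0 := by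
  rw [mem_smul_top_pi] at h
  have h0 : vecComponent b 0 w = w := by rw [vecComponent_of_isHomogeneous hw, if_pos rfl]
  rw [← h0]
  funext j
  rw [vecComponent_apply, MvPolynomial.homogeneousComponent_zero, mem_irrelevantIdeal.mp (h j),
    map_zero]
  rfl

variable {E : Type*} [AddCommGroup E] [Module (Poly K n) E]

theorem exists_constant_lift (f : (Fin b → Poly K n) →ₗ[Poly K n] E)
    (g : (Fin c → Poly K n) →ₗ[Poly K n] E)
    (h : ∀ j, ∃ x : Fin b → Poly K n, (∀ i, (x i).IsHomogeneous 0) ∧ f x = g (Pi.single j 1)) :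
    ∃ S : (Fin c → Poly K n) →ₗ[Poly K n] (Fin b → Poly K n), HasFormEntries 0 S ∧ f ∘ₗ S = g := by
  choose X hX hfX using h
  have hS : ∀ j, Fintype.linearCombination (Poly K n) X (Pi.single j 1) = X j := fun j => by
    simp
  refine ⟨Fintype.linearCombination (Poly K n) X, fun j i => by rw [hS]; exact hX j i, ?_⟩
  ext1 j
  ext1
  exact (congrArg f (hS j)).trans (hfX j)

/-- The columns of `S - id` are constant vectors in `ker f`; since `ker f` lies in the irrelevant
multiples, they vanish. -/
theorem comp_eq_id_of_comp_eq {f : (Fin b → Poly K n) →ₗ[Poly K n] E}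
    {S : (Fin b → Poly K n) →ₗ[Poly K n] (Fin b → Poly K n)}
    (hf : LinearMap.ker f ≤ irrelevantIdeal K n • ⊤) (hS : HasFormEntries 0 S)
    (h : f ∘ₗ S = f) : S = LinearMap.id := by
  have key : ∀ j, S (Pi.single j 1) = Pi.single j 1 := fun j => by
    rw [← sub_eq_zero]
    refine eq_zero_of_isHomogeneous_zero (fun i => ?_) (hf ?_)
    · exact (hS j i).sub (single_one_isHomogeneous j i)
    · rw [LinearMap.mem_ker, map_sub, ← LinearMap.comp_apply, h, sub_self]
  ext1 j
  ext1
  exact key j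

/-- Two minimal presentations by free modules generated in the same degree differ by an
invertible matrix of constants. -/
theorem exists_constant_equiv (f : (Fin b → Poly K n) →ₗ[Poly K n] E)
    (g : (Fin c → Poly K n) →ₗ[Poly K n] E)
    (hf : LinearMap.ker f ≤ irrelevantIdeal K n • ⊤)
    (hg : LinearMap.ker g ≤ irrelevantIdeal K n • ⊤)
    (hfg : ∀ j, ∃ x : Fin b → Poly K n, (∀ i, (x i).IsHomogeneous 0) ∧ f x = g (Pi.single j 1))
    (hgf : ∀ j, ∃ x : Fin c → Poly K n, (∀ i, (x i).IsHomogeneous 0) ∧ g x = f (Pi.single j 1)) :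
    ∃ S : (Fin c → Poly K n) ≃ₗ[Poly K n] (Fin b → Poly K n),
      HasFormEntries 0 (S : (Fin c → Poly K n) →ₗ[Poly K n] (Fin b → Poly K n)) ∧
      LinearMap.ker f = (LinearMap.ker g).map (S : (Fin c → Poly K n) →ₗ[Poly K n] _) := by
  obtain ⟨S, hS, hfS⟩ := exists_constant_lift f g hfg
  obtain ⟨T, hT, hgT⟩ := exists_constant_lift g f hgf
  have hST : S ∘ₗ T = LinearMap.id := comp_eq_id_of_comp_eq hf (hS.comp hT) (by
    rw [← LinearMap.comp_assoc, hfS, hgT])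
  have hTS : T ∘ₗ S = LinearMap.id := comp_eq_id_of_comp_eq hg (hT.comp hS) (by
    rw [← LinearMap.comp_assoc, hgT, hfS])
  refine ⟨LinearEquiv.ofLinearMap S T hST hTS, hS, ?_⟩
  ext w
  rw [Submodule.mem_map]
  constructor
  · intro hw
    refine ⟨T w, ?_, LinearMap.congr_fun hST w⟩
    rw [LinearMap.mem_ker, ← LinearMap.comp_apply, hgT]
    exact hw
  · rintro ⟨v, hv, rfl⟩
    rw [← hfS] at hv
    exact hv

/-- The submodule `W` of `R ^ a` has a resolution of length at most `p` by matrices each of which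
is minimal and has entries that are forms of one degree. -/
def HasPureTail : ℕ → ∀ {a : ℕ}, Submodule (Poly K n) (Fin a → Poly K n) → Prop
  | 0, _, W => W = ⊥
  | p + 1, a, W => ∃ (c e : ℕ) (ψ : (Fin c → Poly K n) →ₗ[Poly K n] (Fin a → Poly K n)),
      HasFormEntries e ψ ∧ LinearMap.ker ψ ≤ irrelevantIdeal K n • ⊤ ∧ LinearMap.range ψ = W ∧
        HasPureTail p (LinearMap.ker ψ)

/-- Only the first matrix of the tail is composed with `S`; its kernel, hence everything after it,
is unchanged. -/
theorem HasPureTail.map {p : ℕ} {W : Submodule (Poly K n) (Fin a → Poly K n)}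
    (hW : HasPureTail p W) (S : (Fin a → Poly K n) ≃ₗ[Poly K n] (Fin b → Poly K n))
    (hS : HasFormEntries 0 (S : (Fin a → Poly K n) →ₗ[Poly K n] (Fin b → Poly K n))) :
    HasPureTail p (W.map (S : (Fin a → Poly K n) →ₗ[Poly K n] (Fin b → Poly K n))) := by
  cases p with
  | zero =>
    change W = ⊥ at hW
    change W.map _ = ⊥
    rw [hW, Submodule.map_bot]
  | succ p =>
    obtain ⟨c, e, ψ, hψ, hker, rfl, htail⟩ := hW
    have hk : LinearMap.ker ((S : (Fin a → Poly K n) →ₗ[Poly K n] (Fin b → Poly K n)) ∘ₗ ψ) =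
        LinearMap.ker ψ := LinearMap.ker_comp_of_ker_eq_bot _ S.ker
    refine ⟨c, e, (S : (Fin a → Poly K n) →ₗ[Poly K n] (Fin b → Poly K n)) ∘ₗ ψ, zero_add e ▸ hS.comp hψ, ?_, LinearMap.range_comp _ _, ?_⟩
    · rwa [hk]
    · rwa [hk]

end HomogeneousMaps

/-! ### One map whose image has initial module generated in a single degree -/

section InitialForms

variable {K : Type*} [Field K] {n a b c e : ℕ}

/-- The matrix of the homogeneous parts of degree `e` of the entries of the matrix of `φ`. -/
noncomputable def formMap (e : ℕ) (φ : (Fin b → PS K n) →ₗ[PS K n] (Fin a → PS K n)) :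
    (Fin b → Poly K n) →ₗ[Poly K n] (Fin a → Poly K n) :=
  Matrix.toLin' ((LinearMap.toMatrix' φ).map (formPart e))

theorem formMap_single (e : ℕ) (φ : (Fin b → PS K n) →ₗ[PS K n] (Fin a → PS K n)) (j : Fin b) :
    formMap e φ (Pi.single j 1) = vecForm a e (φ (Pi.single j 1)) := by
  funext i
  rw [formMap, Matrix.toLin'_apply, Matrix.mulVec_single_one, vecForm_apply, Matrix.col_apply,
    Matrix.map_apply, LinearMap.toMatrix'_apply]

theorem formMap_hasFormEntries (e : ℕ) (φ : (Fin b → PS K n) →ₗ[PS K n] (Fin a → PS K n)) :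
    HasFormEntries e (formMap e φ) := fun j i => by
  rw [formMap_single]
  exact vecForm_isHomogeneous _ _ _

theorem vecForm_map {φ : (Fin b → PS K n) →ₗ[PS K n] (Fin a → PS K n)}
    (hφ : LinearMap.range φ ≤ filt K n (Fin a → PS K n) e) {s : ℕ} {v : Fin b → PS K n}
    (hv : v ∈ filt K n (Fin b → PS K n) s) :
    vecForm a (e + s) (φ v) = formMap e φ (vecForm b s v) := by
  rw [map_eq_sum_smul φ v, map_eq_sum_smul (formMap e φ), map_sum]
  refine Finset.sum_congr rfl fun j _ => funext fun i => ?_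
  rw [formMap_single, vecForm_apply, Pi.smul_apply, smul_eq_mul, Pi.smul_apply, smul_eq_mul,
    mul_comm, formPart_mul (mem_filt_pi.mp (hφ ⟨_, rfl⟩) i) (mem_filt_pi.mp hv j), mul_comm]
  rfl

theorem map_mem_filt_add {φ : (Fin b → PS K n) →ₗ[PS K n] (Fin a → PS K n)}
    (hφ : LinearMap.range φ ≤ filt K n (Fin a → PS K n) e) {s : ℕ} {v : Fin b → PS K n}
    (hv : v ∈ filt K n (Fin b → PS K n) s) : φ v ∈ filt K n (Fin a → PS K n) (e + s) := by
  rw [map_eq_sum_smul φ v]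
  refine Submodule.sum_mem _ fun j _ => ?_
  rw [add_comm]
  exact smul_mem_filt (mem_filt_pi.mp hv j) (hφ ⟨_, rfl⟩)

/-- Successive approximation: a member of the image that can be approximated in each degree by
images of vectors of high order is itself the image of such a vector. -/
theorem exists_map_eq_of_approx {φ : (Fin b → PS K n) →ₗ[PS K n] (Fin a → PS K n)}
    (happrox : ∀ t, ∀ x ∈ LinearMap.range φ, x ∈ filt K n (Fin a → PS K n) (e + t) →
      ∃ v ∈ filt K n (Fin b → PS K n) t, x - φ v ∈ filt K n (Fin a → PS K n) (e + (t + 1)))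
    {t : ℕ} {x : Fin a → PS K n} (hx : x ∈ LinearMap.range φ)
    (hxt : x ∈ filt K n (Fin a → PS K n) (e + t)) :
    ∃ u ∈ filt K n (Fin b → PS K n) t, φ u = x := by
  choose! g hg hxg using happrox
  -- `y k` is what remains of `x` after `k` corrections; `v k` below is the correction made at stage
  -- `k`.
  let y : ℕ → Fin a → PS K n := fun k => Nat.rec x (fun k z => z - φ (g (t + k) z)) k
  have hy : ∀ k, y k ∈ LinearMap.range φ ∧ y k ∈ filt K n (Fin a → PS K n) (e + (t + k)) := by
    intro k
    induction k with
    | zero => exact ⟨hx, hxt⟩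
    | succ k ih => exact ⟨Submodule.sub_mem _ ih.1 ⟨_, rfl⟩, hxg _ _ ih.1 ih.2⟩
  let v : ℕ → Fin b → PS K n := fun k => g (t + k) (y k)
  have hv : ∀ k, v k ∈ filt K n (Fin b → PS K n) (t + k) := fun k => hg _ _ (hy k).1 (hy k).2
  have hsum : ∀ r, φ (∑ k ∈ Finset.range r, v k) = x - y r := by
    intro r
    induction r with
    | zero => exact (map_zero φ).trans (sub_self x).symm
    | succ r ih =>
      rw [Finset.sum_range_succ, map_add, ih]
      change _ = x - (y r - φ (v r))
      abel
  have hcoeff : ∀ k j (m : Fin n →₀ ℕ), m.degree < t + k → MvPowerSeries.coeff m (v k j) = 0 :=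
    fun k j => mem_maxIdeal_pow.mp (mem_filt_pi.mp (hv k) j)
  -- `u` is the infinite sum of the `v k`, formed coefficientwise: `v k` has order at least `t + k`,
  -- so only `k ≤ m.degree` can contribute to the coefficient at `m`.
  obtain ⟨u, hu⟩ : ∃ u : Fin b → PS K n, ∀ j m, MvPowerSeries.coeff m (u j) =
      ∑ k ∈ Finset.range (m.degree + 1), MvPowerSeries.coeff m (v k j) :=
    ⟨fun j m => ∑ k ∈ Finset.range (m.degree + 1), MvPowerSeries.coeff m (v k j), fun _ _ => rfl⟩
  have hclose : ∀ r, u - ∑ k ∈ Finset.range r, v k ∈ filt K n (Fin b → PS K n) r := by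
    intro r
    rw [mem_filt_pi]
    intro j
    rw [mem_maxIdeal_pow]
    intro m hm
    rw [Pi.sub_apply, map_sub, hu, Finset.sum_apply, map_sum, sub_eq_zero]
    refine Finset.sum_subset (Finset.range_mono hm) fun k _ hk => hcoeff k j m ?_
    rw [Finset.mem_range] at hk
    omega
  refine ⟨u, ?_, ?_⟩
  · rw [mem_filt_pi]
    intro j
    rw [mem_maxIdeal_pow]
    intro m hm
    rw [hu]
    exact Finset.sum_eq_zero fun k _ => hcoeff k j m (by omega)
  · rw [← sub_eq_zero]
    refine eq_zero_of_forall_mem_filt fun r => ?_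
    -- Both the image of the tail of the series and the remainder `y r` have order at least `r`, so
    -- no continuity of `φ` is needed beyond `𝔪`-linearity.
    have h : φ u - x = φ (u - ∑ k ∈ Finset.range r, v k) - y r := by
      rw [map_sub, hsum]
      abel
    rw [h]
    exact Submodule.sub_mem _ (map_mem_filt φ (hclose r)) (filt_anti (by omega) (hy r).2)

variable {φ : (Fin b → PS K n) →ₗ[PS K n] (Fin a → PS K n)}
  {ψ : (Fin c → Poly K n) →ₗ[Poly K n] (Fin a → Poly K n)}

theorem range_le_filt (hψ : HasFormEntries e ψ)
    (hr : LinearMap.range ψ = initialModule (LinearMap.range φ)) :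
    LinearMap.range φ ≤ filt K n (Fin a → PS K n) e := by
  refine le_filt_of_forall_lt fun t ht w hw => ?_
  rw [← hr] at hw
  obtain ⟨v, rfl⟩ := hw
  rw [hψ.vecComponent_map, if_neg (by omega)]

/-- A generator of degree `e` is the degree `e` form of some `φ v`. As `φ` raises the order by `e`,
only the constant part of `v` contributes to it. -/
theorem exists_constant_formMap_eq (hψ : HasFormEntries e ψ)
    (hr : LinearMap.range ψ = initialModule (LinearMap.range φ)) (j : Fin c) :
    ∃ x : Fin b → Poly K n, (∀ i, (x i).IsHomogeneous 0) ∧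
      formMap e φ x = ψ (Pi.single j 1) := by
  have hmem : ψ (Pi.single j 1) ∈ initialModule (LinearMap.range φ) := hr ▸ ⟨_, rfl⟩
  obtain ⟨_, ⟨v, rfl⟩, -, hv⟩ := hmem e
  rw [vecComponent_of_isHomogeneous (hψ j), if_pos rfl] at hv
  refine ⟨vecForm b 0 v, vecForm_isHomogeneous _ _, ?_⟩
  rw [← vecForm_map (range_le_filt hψ hr) (by simp [mem_filt_pi]), add_zero, hv]

theorem range_formMap (hψ : HasFormEntries e ψ)
    (hr : LinearMap.range ψ = initialModule (LinearMap.range φ)) :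
    LinearMap.range (formMap e φ) = initialModule (LinearMap.range φ) := by
  apply le_antisymm
  · rintro _ ⟨w, rfl⟩
    rw [map_eq_sum_smul]
    refine Submodule.sum_mem _ fun j _ => Submodule.smul_mem _ _ ?_
    rw [formMap_single]
    exact vecForm_mem_initialModule ⟨_, rfl⟩ (range_le_filt hψ hr ⟨_, rfl⟩)
  · rw [← hr]
    rintro _ ⟨w, rfl⟩
    rw [map_eq_sum_smul]
    refine Submodule.sum_mem _ fun j _ => Submodule.smul_mem _ _ ?_
    obtain ⟨x, -, hx⟩ := exists_constant_formMap_eq hψ hr j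
    exact ⟨x, hx⟩

/-- If the initial module of the image is generated by forms of degree `e`, then the image meets
`𝔪 ^ (e + t) A ^ a` in the image of `𝔪 ^ t A ^ b`. -/
theorem exists_map_eq (hψ : HasFormEntries e ψ)
    (hr : LinearMap.range ψ = initialModule (LinearMap.range φ)) {t : ℕ} {x : Fin a → PS K n}
    (hx : x ∈ LinearMap.range φ) (hxt : x ∈ filt K n (Fin a → PS K n) (e + t)) :
    ∃ u ∈ filt K n (Fin b → PS K n) t, φ u = x := by
  refine exists_map_eq_of_approx (e := e) (fun t x hx hxt => ?_) hx hxt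
  have hφ := range_le_filt hψ hr
  have hmem := vecForm_mem_initialModule hx hxt
  rw [← range_formMap hψ hr] at hmem
  obtain ⟨w, hw⟩ := hmem
  -- The preimage `w` need not be homogeneous; its component of degree `t` already has the required
  -- image, and its lift is the next correction.
  have hcomp := (formMap_hasFormEntries e φ).vecComponent_add_map t w
  rw [hw, vecComponent_of_isHomogeneous (vecForm_isHomogeneous _ x), if_pos rfl] at hcomp
  have hv := vecCoe_mem_filt (vecComponent_isHomogeneous t w)
  refine ⟨_, hv, mem_filt_succ (s := e + t) (Submodule.sub_mem _ hxt (map_mem_filt_add hφ hv)) ?_⟩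
  rw [map_sub, vecForm_map hφ hv, vecForm_vecCoe,
    vecComponent_of_isHomogeneous (vecComponent_isHomogeneous t w), if_pos rfl, hcomp, sub_self]

/-- If `in(φ)` kills a form of degree `s`, then `φ` sends its lift into order `e + s + 1`, one more
than expected. By strictness that image is also `φ u` with `u` of order `s + 1`; subtracting `u`
gives a member of `ker φ` with the same leading form. -/
theorem ker_formMap (hψ : HasFormEntries e ψ)
    (hr : LinearMap.range ψ = initialModule (LinearMap.range φ)) :
    LinearMap.ker (formMap e φ) = initialModule (LinearMap.ker φ) := by
  have hφ := range_le_filt hψ hr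
  apply le_antisymm
  · intro w hw s
    have hv := vecCoe_mem_filt (vecComponent_isHomogeneous s w)
    have hform : vecForm b s (vecCoe b (vecComponent b s w)) = vecComponent b s w := by
      rw [vecForm_vecCoe, vecComponent_of_isHomogeneous (vecComponent_isHomogeneous s w),
        if_pos rfl]
    have hφv : φ (vecCoe b (vecComponent b s w)) ∈ filt K n (Fin a → PS K n) (e + (s + 1)) := by
      refine mem_filt_succ (s := e + s) (map_mem_filt_add hφ hv) ?_
      rw [vecForm_map hφ hv, hform, ← (formMap_hasFormEntries e φ).vecComponent_add_map,
        LinearMap.mem_ker.mp hw, map_zero]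
    obtain ⟨u, hu, huv⟩ := exists_map_eq hψ hr ⟨_, rfl⟩ hφv
    refine ⟨vecCoe b (vecComponent b s w) - u, ?_,
      Submodule.sub_mem _ hv (filt_anti s.le_succ hu), ?_⟩
    · rw [LinearMap.mem_ker, map_sub, huv, sub_self]
    · rw [map_sub, hform, vecForm_eq_zero hu, sub_zero]
  · intro w hw
    refine mem_of_forall_vecComponent_mem fun s => ?_
    obtain ⟨x, hx, hxs, hxw⟩ := hw s
    rw [← hxw, LinearMap.mem_ker, ← vecForm_map hφ hxs, LinearMap.mem_ker.mp hx, map_zero]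

theorem initialForm_eq_formMap (hψ : HasFormEntries e ψ)
    (hr : LinearMap.range ψ = initialModule (LinearMap.range φ)) :
    initialForm φ = formMap e φ := by
  change formMap (order φ) φ = formMap e φ
  by_cases h0 : φ = 0
  -- The degree `e` is not determined by a zero map, but all homogeneous parts of a zero matrix
  -- vanish, so the value of `order` is irrelevant here.
  · subst h0
    ext1 j
    ext1
    simp [formMap_single]
  · have hg : IsGreatest {s : ℕ | LinearMap.range φ ≤ maxIdeal K n ^ s • ⊤} e := by
      -- If the image had order above `e`, all forms of degree `e` would vanish; they generate the
      -- initial module, so the image would be zero.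
      refine ⟨range_le_filt hψ hr, fun s hs => ?_⟩
      by_contra! hlt
      refine h0 (LinearMap.range_eq_bot.mp (eq_bot_of_initialModule_eq_bot ?_))
      rw [← range_formMap hψ hr, LinearMap.range_eq_bot]
      have hle : LinearMap.range φ ≤ filt K n (Fin a → PS K n) (e + 1) := hs.trans (filt_anti hlt)
      ext1 j
      ext1
      change formMap e φ (Pi.single j 1) = 0
      rw [formMap_single, vecForm_eq_zero (hle ⟨_, rfl⟩)]
    rw [order, hg.csSup_eq]

theorem range_initialForm (hψ : HasFormEntries e ψ)
    (hr : LinearMap.range ψ = initialModule (LinearMap.range φ)) :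
    LinearMap.range (initialForm φ) = initialModule (LinearMap.range φ) := by
  rw [initialForm_eq_formMap hψ hr, range_formMap hψ hr]

theorem ker_initialForm (hψ : HasFormEntries e ψ)
    (hr : LinearMap.range ψ = initialModule (LinearMap.range φ)) :
    LinearMap.ker (initialForm φ) = initialModule (LinearMap.ker φ) := by
  rw [initialForm_eq_formMap hψ hr, ker_formMap hψ hr]

/-- The inductive step: `formMap e φ` and `ψ` are minimal presentations of the same module with
generators in degree `e`, so a constant change of basis carries `ker ψ` to `(ker φ)*`. -/
theorem HasPureTail.initialModule_ker {p : ℕ} (hψ : HasFormEntries e ψ)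
    (hr : LinearMap.range ψ = initialModule (LinearMap.range φ))
    (hφ : LinearMap.ker φ ≤ maxIdeal K n • ⊤)
    (hker : LinearMap.ker ψ ≤ irrelevantIdeal K n • ⊤) (h : HasPureTail p (LinearMap.ker ψ)) :
    HasPureTail p (initialModule (LinearMap.ker φ)) := by
  have hf : LinearMap.ker (formMap e φ) ≤ irrelevantIdeal K n • ⊤ := by
    rw [ker_formMap hψ hr]
    exact initialModule_le_irrelevantIdeal hφ
  obtain ⟨S, hS, hSk⟩ := exists_constant_equiv (formMap e φ) ψ hf hker
    (exists_constant_formMap_eq hψ hr) fun j => by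
      have hmem : formMap e φ (Pi.single j 1) ∈ LinearMap.range ψ := by
        rw [hr, ← range_formMap hψ hr]
        exact ⟨_, rfl⟩
      obtain ⟨w, hw⟩ := hmem
      refine ⟨vecComponent c 0 w, vecComponent_isHomogeneous 0 w, ?_⟩
      rw [← hψ.vecComponent_add_map, hw, add_zero,
        vecComponent_of_isHomogeneous (formMap_hasFormEntries e φ j), if_pos rfl]
  rw [← ker_formMap hψ hr, hSk]
  exact h.map S hS

end InitialForms

/-! ### Induction along the resolution -/

section Induction

variable {K : Type*} [Field K] {n : ℕ}

/-- Otherwise the vector with all entries `1` would lie in the kernel, giving `1 ∈ 𝔪`. -/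
theorem rank_eq_zero_of_ker_eq_top {a b : ℕ} {φ : (Fin b → PS K n) →ₗ[PS K n] (Fin a → PS K n)}
    (hφ : LinearMap.ker φ ≤ maxIdeal K n • ⊤) (h : LinearMap.range φ = ⊥) : b = 0 := by
  by_contra hb
  rw [LinearMap.range_eq_bot] at h
  subst h
  have h1 := (mem_smul_top_pi _ _).mp (hφ (x := fun _ => 1) rfl) ⟨0, Nat.pos_of_ne_zero hb⟩
  have h2 : (1 : PS K n) ∈ maxIdeal K n ^ 1 := by rwa [pow_one]
  have h3 := mem_maxIdeal_pow.mp h2 0 (by simp)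
  simp at h3

/-- A minimal resolution over `A` of a submodule whose initial module has a pure tail stays exact
on passing to initial forms. -/
theorem exact_initialForm_of_hasPureTail {p : ℕ} (b : ℕ → ℕ)
    (φ : (i : ℕ) → (Fin (b (i + 1)) → PS K n) →ₗ[PS K n] (Fin (b i) → PS K n))
    (hex : ∀ i, LinearMap.ker (φ i) = LinearMap.range (φ (i + 1)))
    (hmin : ∀ i, LinearMap.range (φ i) ≤ maxIdeal K n • ⊤)
    (hp : HasPureTail p (initialModule (LinearMap.range (φ 0)))) :
    (∃ q, ∀ i, q < i → b i = 0) ∧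
      LinearMap.range (initialForm (φ 0)) = initialModule (LinearMap.range (φ 0)) ∧
      ∀ i, Function.Exact (initialForm (φ (i + 1))) (initialForm (φ i)) := by
  have hmin' : ∀ i, LinearMap.ker (φ i) ≤ maxIdeal K n • ⊤ := fun i => hex i ▸ hmin (i + 1)
  induction p generalizing b with
  | zero =>
    have hp' : initialModule (LinearMap.range (φ 0)) = ⊥ := hp
    have hb : ∀ i, b (i + 1) = 0 := by
      intro i
      induction i with
      | zero => exact rank_eq_zero_of_ker_eq_top (hmin' 0) (eq_bot_of_initialModule_eq_bot hp')
      | succ i ih =>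
        have : IsEmpty (Fin (b (i + 1))) := by rw [ih]; infer_instance
        exact rank_eq_zero_of_ker_eq_top (hmin' (i + 1)) (Subsingleton.elim _ _)
    have hsub : ∀ i, Subsingleton (Fin (b (i + 1)) → Poly K n) := fun i => by
      have : IsEmpty (Fin (b (i + 1))) := by rw [hb]; infer_instance
      infer_instance
    refine ⟨⟨0, fun i hi => ?_⟩, ?_, fun i x => ?_⟩
    · obtain ⟨k, rfl⟩ := Nat.exists_eq_succ_of_ne_zero hi.ne'
      exact hb k
    · rw [hp', LinearMap.range_eq_bot]
      exact LinearMap.ext fun x => by rw [(hsub 0).elim x 0, map_zero, map_zero]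
    · have := hsub i
      exact ⟨fun _ => ⟨0, (hsub i).elim _ _⟩, fun _ => by rw [(hsub i).elim x 0, map_zero]⟩
  | succ p ih =>
    obtain ⟨c, e, ψ, hψ, hker, hr, htail⟩ := hp
    have htail' := HasPureTail.initialModule_ker hψ hr (hmin' 0) hker htail
    rw [hex 0] at htail'
    obtain ⟨⟨q, hq⟩, hrange, hexact⟩ := ih (fun i => b (i + 1)) (fun i => φ (i + 1))
      (fun i => hex (i + 1)) (fun i => hmin (i + 1)) htail' (fun i => hmin' (i + 1))
    refine ⟨⟨q + 1, fun i hi => ?_⟩, range_initialForm hψ hr, fun i => ?_⟩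
    · obtain ⟨k, rfl⟩ := Nat.exists_eq_succ_of_ne_zero (by omega : i ≠ 0)
      exact hq k (by omega)
    · cases i with
      | zero =>
        -- The image formula for the shifted complex is what closes this junction; it is part of the
        -- induction statement for this reason.
        rw [LinearMap.exact_iff, ker_initialForm hψ hr, hex 0]
        exact hrange.symm
      | succ i => exact hexact i

end Induction

/-! ### Homogeneous classes in `G_𝔪(M)` -/

section GradedPieces

variable {K : Type*} [Field K] {n : ℕ} {M : Type*} [AddCommGroup M] [Module (PS K n) M]

/-- The projection of `G_𝔪(M)` onto its `i`-th piece. -/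
noncomputable def grProj (i : ℕ) : AssocGraded K n M →+ GrPiece K n M i :=
  DFinsupp.evalAddMonoidHom (β := GrPiece K n M) i

theorem grProj_grOf_same (i : ℕ) (y : GrPiece K n M i) : grProj i (grOf K n M i y) = y :=
  DirectSum.of_eq_same (β := GrPiece K n M) i y

theorem grProj_grOf_of_ne {i j : ℕ} (h : i ≠ j) (y : GrPiece K n M i) :
    grProj j (grOf K n M i y) = 0 :=
  DirectSum.of_eq_of_ne (β := GrPiece K n M) i j y h.symm

theorem grProj_of_mem_of_ne {i j : ℕ} (h : i ≠ j) {x : AssocGraded K n M}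
    (hx : x ∈ grGrading K n M i) : grProj j x = 0 := by
  obtain ⟨y, rfl⟩ := hx
  exact grProj_grOf_of_ne h y

theorem eq_of_grProj_eq {i : ℕ} {x y : AssocGraded K n M} (hx : x ∈ grGrading K n M i)
    (hy : y ∈ grGrading K n M i) (h : grProj i x = grProj i y) : x = y := by
  obtain ⟨x, rfl⟩ := hx
  obtain ⟨y, rfl⟩ := hy
  rw [grProj_grOf_same, grProj_grOf_same] at h
  rw [h]

/-- The map sending a member of `𝔪 ^ i M` to its class in `G_𝔪(M)`. -/
noncomputable def grClass (i : ℕ) : filt K n M i →+ AssocGraded K n M :=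
  (grOf K n M i).comp
    (Submodule.mkQ ((filt K n M (i + 1)).submoduleOf (filt K n M i))).toAddMonoidHom

theorem grClass_apply {i : ℕ} {x : M} (hx : x ∈ filt K n M i) :
    grClass i ⟨x, hx⟩ = grOf K n M i (grMk i x hx) := rfl

theorem smul_grClass {i j k : ℕ} (h : i + j = k) {p : Poly K n} (hp : p.IsHomogeneous i) {x : M}
    (hx : x ∈ filt K n M j) (hpx : (p : PS K n) • x ∈ filt K n M k) :
    p • grClass j ⟨x, hx⟩ = grClass k ⟨(p : PS K n) • x, hpx⟩ := by
  subst h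
  rw [grClass_apply, grClass_apply]
  exact smul_grOf_grMk hp hx

theorem grClass_mem (i : ℕ) (x : filt K n M i) : grClass i x ∈ grGrading K n M i := ⟨_, rfl⟩

theorem grClass_eq_zero {i : ℕ} {x : filt K n M i} :
    grClass i x = 0 ↔ (x : M) ∈ filt K n M (i + 1) := by
  have hinj : Function.Injective (grOf K n M i) := DirectSum.of_injective (β := GrPiece K n M) i
  rw [← Subtype.coe_eta x x.2, grClass_apply, ← map_zero (grOf K n M i), hinj.eq_iff]
  exact Submodule.Quotient.mk_eq_zero _

end GradedPieces

/-! ### Graded maps and their homogeneous components -/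

section GradedMaps

variable {K : Type*} [Field K] {n a b d : ℕ} {M : Type*} [AddCommGroup M] [Module (PS K n) M]

theorem isHomogeneous_iff {p : Poly K n} {s : ℕ} :
    p.IsHomogeneous s ↔ ∀ m ∈ p.support, m.degree = s := by
  simp_rw [Finsupp.degree_eq_weight_one, MvPolynomial.mem_support_iff]
  exact ⟨fun h m hm => h hm, fun h m hm => h m hm⟩

theorem mem_twist_iff {w : Fin b → Poly K n} {e : ℕ} :
    w ∈ twist (fun _ => d) e ↔ (d ≤ e ∧ ∀ j, (w j).IsHomogeneous (e - d)) ∨ w = 0 := by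
  constructor
  · intro hw
    by_cases hd : d ≤ e
    · refine Or.inl ⟨hd, fun j => isHomogeneous_iff.mpr fun m hm => ?_⟩
      have := hw j m hm
      rw [eq_tsub_iff_add_eq_of_le hd]
      exact this
    · refine Or.inr (funext fun j => ?_)
      rw [Pi.zero_apply, ← MvPolynomial.support_eq_empty]
      refine Finset.eq_empty_of_forall_notMem fun m hm => ?_
      exact hd (le_of_add_le_right (hw j m hm).le)
  · rintro (⟨hd, hw⟩ | rfl)
    · intro j m hm
      exact (eq_tsub_iff_add_eq_of_le hd).mp (isHomogeneous_iff.mp (hw j) m hm)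
    · exact zero_mem _

theorem HasFormEntries.map_mem_twist {v : ℕ}
    {ψ : (Fin b → Poly K n) →ₗ[Poly K n] (Fin a → Poly K n)} (hψ : HasFormEntries v ψ) {e : ℕ}
    {w : Fin b → Poly K n} (hw : w ∈ twist (fun _ => d + v) e) : ψ w ∈ twist (fun _ => d) e := by
  rcases mem_twist_iff.mp hw with ⟨hd, hw⟩ | rfl
  · refine mem_twist_iff.mpr (Or.inl ⟨by omega, fun i => ?_⟩)
    have := hψ.isHomogeneous_map hw i
    rwa [show v + (e - (d + v)) = e - d by omega] at this
  · rw [map_zero]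
    exact zero_mem _

/-- The map `f` from `R(-d) ^ b` to `G_𝔪(M)` is homogeneous of degree `0`. -/
def IsGradedMap (d : ℕ) (f : (Fin b → Poly K n) →ₗ[Poly K n] AssocGraded K n M) : Prop :=
  ∀ s w, (∀ j, (w j).IsHomogeneous s) → f w ∈ grGrading K n M (s + d)

variable {f : (Fin b → Poly K n) →ₗ[Poly K n] AssocGraded K n M}

theorem IsGradedMap.grProj_eq_zero (hf : IsGradedMap d f) {t : ℕ} {w : Fin b → Poly K n}
    (h : ∀ s, s + d = t → vecComponent b s w = 0) : grProj t (f w) = 0 := by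
  obtain ⟨N, hN⟩ := exists_eq_sum_vecComponent w
  rw [hN, map_sum, map_sum]
  refine Finset.sum_eq_zero fun s _ => ?_
  by_cases hs : s + d = t
  · rw [h s hs, map_zero, map_zero]
  · exact grProj_of_mem_of_ne hs (hf s _ (vecComponent_isHomogeneous s w))

theorem IsGradedMap.grProj_eq (hf : IsGradedMap d f) (s : ℕ) (w : Fin b → Poly K n) :
    grProj (s + d) (f w) = grProj (s + d) (f (vecComponent b s w)) := by
  rw [← sub_eq_zero, ← map_sub, ← map_sub]
  refine hf.grProj_eq_zero fun t ht => ?_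
  obtain rfl : t = s := by omega
  rw [map_sub, vecComponent_of_isHomogeneous (vecComponent_isHomogeneous t w), if_pos rfl, sub_self]

theorem IsGradedMap.eq_map_vecComponent (hf : IsGradedMap d f) {s : ℕ} {w : Fin b → Poly K n}
    (hw : f w ∈ grGrading K n M (s + d)) : f w = f (vecComponent b s w) :=
  eq_of_grProj_eq hw (hf s _ (vecComponent_isHomogeneous s w)) (hf.grProj_eq s w)

theorem IsGradedMap.eq_zero_of_lt (hf : IsGradedMap d f) {t : ℕ} (ht : t < d)
    {w : Fin b → Poly K n} (hw : f w ∈ grGrading K n M t) : f w = 0 := by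
  refine eq_of_grProj_eq hw (zero_mem _) ?_
  rw [map_zero, hf.grProj_eq_zero fun s hs => by omega]

theorem eq_zero_of_forall_single {S N : Type*} [CommRing S] [AddCommGroup N] [Module S N]
    {g : (Fin b → S) →ₗ[S] N} (h : ∀ j, g (Pi.single j 1) = 0) : g = 0 := by
  ext1 j
  ext1
  exact h j

end GradedMaps

/-! ### The augmentation and its kernel -/

section Augmentation

variable {K : Type*} [Field K] {n b : ℕ} {M : Type*} [AddCommGroup M] [Module (PS K n) M]

theorem mem_filt_zero (x : M) : x ∈ filt K n M 0 := by simp [filt]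

theorem augmentation_apply (π : (Fin b → PS K n) →ₗ[PS K n] M) (w : Fin b → Poly K n) :
    augmentation π w = ∑ j, w j • grClass 0 ⟨π (Pi.single j 1), mem_filt_zero _⟩ :=
  Fintype.linearCombination_apply _ _ _

theorem augmentation_of_isHomogeneous (π : (Fin b → PS K n) →ₗ[PS K n] M) {s : ℕ}
    {w : Fin b → Poly K n} (hw : ∀ j, (w j).IsHomogeneous s) :
    augmentation π w = grClass s ⟨π (vecCoe b w), map_mem_filt π (vecCoe_mem_filt hw)⟩ := by
  have h0 : ∀ j, π (Pi.single j 1) ∈ filt K n M 0 := fun j => mem_filt_zero _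
  have h : ∀ j, (w j : PS K n) • π (Pi.single j 1) ∈ filt K n M s := fun j => by
    simpa using smul_mem_filt (coe_mem_pow (hw j)) (h0 j)
  have hsum : (⟨π (vecCoe b w), map_mem_filt π (vecCoe_mem_filt hw)⟩ : filt K n M s) =
      ∑ j, ⟨(w j : PS K n) • π (Pi.single j 1), h j⟩ := by
    apply Subtype.ext
    rw [AddSubmonoidClass.coe_finsetSum]
    refine (map_eq_sum_smul π _).trans ?_
    exact Finset.sum_congr rfl fun j _ => by rw [vecCoe_apply]
  rw [hsum, map_sum, augmentation_apply]
  refine Finset.sum_congr rfl fun j _ => ?_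
  rw [smul_grClass (add_zero s) (hw j) (h0 j) (h j)]

theorem augmentation_isGradedMap (π : (Fin b → PS K n) →ₗ[PS K n] M) :
    IsGradedMap 0 (augmentation π) := fun s w hw => by
  rw [augmentation_of_isHomogeneous π hw]
  exact grClass_mem s _

theorem exists_mem_filt_map_eq {π : (Fin b → PS K n) →ₗ[PS K n] M} (hπ : Function.Surjective π)
    {s : ℕ} {x : M} (hx : x ∈ filt K n M s) :
    ∃ v ∈ filt K n (Fin b → PS K n) s, π v = x := by
  rw [filt, ← LinearMap.range_eq_top.mpr hπ, ← map_filt] at hx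
  exact hx

theorem augmentation_vecForm (π : (Fin b → PS K n) →ₗ[PS K n] M) {s : ℕ} {v : Fin b → PS K n}
    (hv : v ∈ filt K n (Fin b → PS K n) s) :
    augmentation π (vecForm b s v) = grClass s ⟨π v, map_mem_filt π hv⟩ := by
  rw [augmentation_of_isHomogeneous π (vecForm_isHomogeneous s v), eq_comm, ← sub_eq_zero,
    ← map_sub, grClass_eq_zero]
  change π v - π _ ∈ _
  rw [← map_sub]
  exact map_mem_filt π (sub_vecCoe_vecForm_mem hv)

theorem augmentation_surjective {π : (Fin b → PS K n) →ₗ[PS K n] M} (hπ : Function.Surjective π) :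
    Function.Surjective (augmentation π) := by
  intro x
  change x ∈ LinearMap.range (augmentation π)
  induction x using DirectSum.induction_on with
  | zero => exact zero_mem _
  | of s y =>
    obtain ⟨x, hx, rfl⟩ := grMk_surjective y
    obtain ⟨v, hv, rfl⟩ := exists_mem_filt_map_eq hπ hx
    exact ⟨_, augmentation_vecForm π hv⟩
  | add x y hx hy => exact add_mem hx hy

/-- A form of degree `s` is killed exactly when `π` sends its lift into `𝔪 ^ (s + 1) M`. As `π` is
surjective, that image is also attained on `𝔪 ^ (s + 1) A ^ b`, and the difference is a member of
`ker π` with the given leading form. -/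
theorem ker_augmentation {π : (Fin b → PS K n) →ₗ[PS K n] M} (hπ : Function.Surjective π) :
    LinearMap.ker (augmentation π) = initialModule (LinearMap.ker π) := by
  have hgr := augmentation_isGradedMap π
  apply le_antisymm
  · intro w hw s
    have hs := vecComponent_isHomogeneous s w
    have h0 : augmentation π (vecComponent b s w) = 0 := by
      rw [← hgr.eq_map_vecComponent (s := s) (w := w), LinearMap.mem_ker.mp hw]
      rw [LinearMap.mem_ker.mp hw]
      exact zero_mem _
    rw [augmentation_of_isHomogeneous π hs, grClass_eq_zero] at h0
    obtain ⟨u, hu, huv⟩ := exists_mem_filt_map_eq hπ h0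
    refine ⟨vecCoe b (vecComponent b s w) - u, ?_,
      Submodule.sub_mem _ (vecCoe_mem_filt hs) (filt_anti s.le_succ hu), ?_⟩
    · rw [LinearMap.mem_ker, map_sub, huv, sub_self]
    · rw [map_sub, vecForm_vecCoe, vecForm_eq_zero hu, sub_zero, vecComponent_of_isHomogeneous hs,
        if_pos rfl]
  · intro w hw
    refine mem_of_forall_vecComponent_mem fun s => ?_
    obtain ⟨x, hx, hxs, hxw⟩ := hw s
    rw [← hxw, LinearMap.mem_ker, augmentation_vecForm π hxs, grClass_eq_zero]
    change π x ∈ _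
    rw [LinearMap.mem_ker.mp hx]
    exact zero_mem _

end Augmentation

/-! ### Transfer from the given pure resolution, and the theorem -/

section PureResolution

variable {K : Type*} [Field K] {n : ℕ} {M : Type*} [AddCommGroup M] [Module (PS K n) M]

/-- The truncated subtraction is harmless: if `d' < d`, each basis vector maps to zero, which is a
form of every degree. -/
theorem hasFormEntries_of_map_mem_twist {a b d d' : ℕ}
    {ψ : (Fin b → Poly K n) →ₗ[Poly K n] (Fin a → Poly K n)}
    (h : ∀ e, ∀ w ∈ twist (fun _ => d') e, ψ w ∈ twist (fun _ => d) e) :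
    HasFormEntries (d' - d) ψ := by
  intro j i
  have hj : (Pi.single j 1 : Fin b → Poly K n) ∈ twist (fun _ => d') d' :=
    mem_twist_iff.mpr (Or.inl ⟨le_rfl, by
      rw [Nat.sub_self]
      exact single_one_isHomogeneous j⟩)
  rcases mem_twist_iff.mp (h _ _ hj) with ⟨-, h⟩ | h
  · exact h i
  · rw [h]
    exact MvPolynomial.isHomogeneous_zero _ _ _

theorem hasPureTail_ker_augmentation (hG : HasPureResolution K n (grGrading K n M)) {b : ℕ}
    {π : (Fin b → PS K n) →ₗ[PS K n] M} (hπ : Function.Surjective π)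
    (hker : LinearMap.ker π ≤ maxIdeal K n • ⊤) :
    ∃ p, HasPureTail p (LinearMap.ker (augmentation π)) := by
  obtain ⟨c, d, ψ, ε, h⟩ := hG
  obtain ⟨p, hp⟩ := h.finite_length
  have hform : ∀ i, HasFormEntries (d (i + 1) - d i) (ψ i) := fun i =>
    hasFormEntries_of_map_mem_twist (h.graded_map i)
  have hexact : ∀ i, LinearMap.ker (ψ i) = LinearMap.range (ψ (i + 1)) := fun i =>
    LinearMap.exact_iff.mp (h.exact_succ i)
  have hmin : ∀ i, LinearMap.ker (ψ i) ≤ irrelevantIdeal K n • ⊤ := fun i => by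
    rw [hexact]
    exact h.minimal _
  have htail : ∀ k i, p < i + 1 + k → HasPureTail k (LinearMap.ker (ψ i)) := by
    intro k
    induction k with
    | zero =>
      intro i hi
      have : IsEmpty (Fin (c (i + 1))) := by
        rw [hp _ hi]
        infer_instance
      exact Subsingleton.elim (LinearMap.ker (ψ i)) ⊥
    | succ k ih =>
      intro i hi
      exact ⟨_, _, ψ (i + 1), hform _, hmin _, (hexact i).symm, ih (i + 1) (by omega)⟩
  have hεker : LinearMap.ker ε = LinearMap.range (ψ 0) := LinearMap.exact_iff.mp h.exact_zero
  have hε : IsGradedMap (d 0) ε := fun s w hw =>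
    h.graded_augmentation _ _ (mem_twist_iff.mpr (Or.inl ⟨Nat.le_add_left _ _, by
      rwa [Nat.add_sub_cancel]⟩))
  have hπgr := augmentation_isGradedMap π
  have hsurj := augmentation_surjective hπ
  have hgen : ∀ j, augmentation π (Pi.single j 1) ∈ grGrading K n M 0 := fun j =>
    hπgr 0 _ (single_one_isHomogeneous j)
  have hεgen : ∀ j, ε (Pi.single j 1) ∈ grGrading K n M (d 0) := fun j => by
    have := hε 0 _ (single_one_isHomogeneous j)
    rwa [zero_add] at this
  have hzero : ∀ (m : ℕ) (i : Fin m), ((0 : Fin m → Poly K n) i).IsHomogeneous 0 := fun m i =>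
    MvPolynomial.isHomogeneous_zero _ _ _
  -- `G_𝔪(M)` is generated in degree `0`, whereas `ε` reaches no degree below `d 0`. So `0 < d 0`
  -- happens only if `G_𝔪(M) = 0`, and then zero vectors serve as preimages on both sides.
  have hlow : 0 < d 0 → ∀ j, augmentation π (Pi.single j 1) = 0 := fun hd j => by
    obtain ⟨v, hv⟩ := h.augmentation_surjective (augmentation π (Pi.single j 1))
    have hmem := hgen j
    rw [← hv] at hmem ⊢
    exact hε.eq_zero_of_lt hd hmem
  obtain ⟨S, hS, hSk⟩ := exists_constant_equiv (augmentation π) ε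
    (by rw [ker_augmentation hπ]; exact initialModule_le_irrelevantIdeal hker)
    (by rw [hεker]; exact h.minimal 0)
    (fun j => by
      obtain ⟨v, hv⟩ := hsurj (ε (Pi.single j 1))
      rcases Nat.eq_zero_or_pos (d 0) with hd | hd
      · have hmem := hεgen j
        rw [← hv, hd] at hmem
        refine ⟨vecComponent b 0 v, vecComponent_isHomogeneous 0 v, ?_⟩
        rw [← hv, ← hπgr.eq_map_vecComponent (s := 0) hmem]
      · refine ⟨0, hzero b, ?_⟩
        rw [← hv, eq_zero_of_forall_single (hlow hd), LinearMap.zero_apply, LinearMap.zero_apply])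
    (fun j => by
      rcases Nat.eq_zero_or_pos (d 0) with hd | hd
      · obtain ⟨v, hv⟩ := h.augmentation_surjective (augmentation π (Pi.single j 1))
        have hmem := hgen j
        rw [← hv] at hmem
        refine ⟨vecComponent (c 0) 0 v, vecComponent_isHomogeneous 0 v, ?_⟩
        rw [← hv, ← hε.eq_map_vecComponent (s := 0) (by rwa [hd])]
      · exact ⟨0, hzero _, by rw [hlow hd, map_zero]⟩)
  refine ⟨p + 1, ?_⟩
  rw [hSk]
  exact HasPureTail.map (p := p + 1)
    ⟨_, _, ψ 0, hform 0, hmin 0, hεker.symm, htail p 0 (by omega)⟩ S hS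

theorem range_initialForm_le {a b : ℕ} {φ : (Fin b → PS K n) →ₗ[PS K n] (Fin a → PS K n)}
    (hφ : LinearMap.range φ ≤ maxIdeal K n • ⊤) :
    LinearMap.range (initialForm φ) ≤ irrelevantIdeal K n • ⊤ := by
  rintro _ ⟨w, rfl⟩
  rw [map_eq_sum_smul]
  refine Submodule.sum_mem _ fun j _ => Submodule.smul_mem _ _ ((mem_smul_top_pi _ _).mpr fun i => ?_)
  change formMap (order φ) φ _ i ∈ _
  rw [formMap_single, mem_irrelevantIdeal, vecForm_apply, coeff_formPart]
  split_ifs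
  · have h := (mem_smul_top_pi _ _).mp (hφ ⟨Pi.single j 1, rfl⟩) i
    rw [← pow_one (maxIdeal K n)] at h
    exact mem_maxIdeal_pow.mp h 0 (by simp)
  · rfl

end PureResolution

end PureRes

theorem theorem1p1 {K : Type*} [Field K] (n : ℕ) {M : Type*} [AddCommGroup M]
    [Module (PureRes.PS K n) M] [Module.Finite (PureRes.PS K n) M]
    (hG : PureRes.HasPureResolution K n (PureRes.grGrading K n M))
    (b : ℕ → ℕ)
    (φ : (i : ℕ) → (Fin (b (i + 1)) → PureRes.PS K n) →ₗ[PureRes.PS K n]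
      (Fin (b i) → PureRes.PS K n))
    (π : (Fin (b 0) → PureRes.PS K n) →ₗ[PureRes.PS K n] M)
    (hF : PureRes.IsMinimalFreeResolution b φ π) :
    PureRes.IsMinimalGradedFreeResolution (PureRes.grGrading K n M) b
      (fun i _ => ∑ j ∈ Finset.range i, PureRes.order (φ j))
      (fun i => PureRes.initialForm (φ i))
      (PureRes.augmentation π) := by
  have hex : ∀ i, LinearMap.ker (φ i) = LinearMap.range (φ (i + 1)) := fun i =>
    LinearMap.exact_iff.mp (hF.exact_succ i)
  have hker : LinearMap.ker π = LinearMap.range (φ 0) := LinearMap.exact_iff.mp hF.exact_zero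
  have hπ := hF.augmentation_surjective
  obtain ⟨p, hp⟩ := PureRes.hasPureTail_ker_augmentation hG hπ (hker ▸ hF.minimal 0)
  rw [PureRes.ker_augmentation hπ, hker] at hp
  obtain ⟨hlen, hrange, hexact⟩ :=
    PureRes.exact_initialForm_of_hasPureTail b φ hex hF.minimal hp
  refine ⟨hlen, fun i e w hw => ?_, fun e w hw => ?_, PureRes.augmentation_surjective hπ, ?_,
    hexact, fun i => PureRes.range_initialForm_le (hF.minimal i)⟩
  · refine (PureRes.formMap_hasFormEntries (PureRes.order (φ i)) (φ i)).map_mem_twist ?_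
    -- The twists of consecutive free modules differ by the order of the map between them, which is
    -- the degree of the entries of its initial form.
    rwa [Finset.sum_range_succ] at hw
  · rcases PureRes.mem_twist_iff.mp hw with ⟨-, hw⟩ | rfl
    · exact PureRes.augmentation_isGradedMap π e w hw
    · rw [map_zero]
      exact zero_mem _
  · rw [LinearMap.exact_iff, PureRes.ker_augmentation hπ, hker, hrange]
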